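/- Let $T\ge 1$ and $s\ge 0$ be integers, let $N_1,K_1,\dots,N_s,K_s$ be nonnegative integers, $M_l=\sum_{k=1}^{l}(N_k+K_k)$ ($M_0=0$), and let $$\mathcal O=\{\dots,-2,-1\}\setminus\bigcup_{l=1}^{s}\{-M_l,\dots,-M_{l-1}-N_l-1\}$$ be the set of observed times. Let $a(j)$, $j\ge 1$, be complex numbers with $\sum_{j\ge1}|a(j)|<\infty$, put $\vec a(j)=(a(1+jT),\dots,a(T+jT))^\top$ for $j\ge 0$, and $A(e^{i\lambda})=\sum_{j\ge 0}\vec a(j)e^{ij\lambda}$. (Thus $A\vec\zeta=\sum_{j\ge0}\vec a(j)^\top\vec\zeta(j)$ is the functional $\sum_{j\ge1}a(j)\zeta(j)$ of a $T$-periodically correlated sequence $\zeta$ blocked into $\vec\zeta(j)=(\zeta(1+jT),\dots,\zeta(T+jT))^\top$; it is to be estimated linearly from $\vec\zeta(j)+\vec\theta(j)$, $j\in\mathcal O$, where $\vec\theta$ is uncorrelated with $\vec\zeta$.) A spectral density is an integrable function $f$ on $[-\pi,\pi]$ whose values are, almost everywhere, Hermitian positive semidefinite $T\times T$ matrices. For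 a spectral density $F$, let $L_2(F)$ be the space of measurable $\vec b:[-\pi,\pi]\to\mathbb C^T$ with $\int_{-\pi}^{\pi}\vec b^\top F\,\overline{\vec b}\,d\lambda<\infty$, and let $L_2^s(F)$ be the closure in $L_2(F)$ of the linear span of the functions $e^{ij\lambda}\delta_\nu$, $j\in\mathcal O$, $\nu=1,\dots,T$, where $\delta_1,\dots,\delta_T$ is the standard basis of $\mathbb C^T$. For spectral densities $f$ (of $\vec\zeta$) and $g$ (of $\vec\theta$), the mean square error of the linear estimate with spectral characteristic $\vec h$ is $$\Delta(\vec h;f,g)=\frac1{2\pi}\int_{-\pi}^{\pi}\bigl[A(e^{i\lambda})-\vec h(\lambda)\bigr]^\top f(\lambda)\,\overline{\bigl[A(e^{i\lambda})-\vec h(\lambda)\bigr]}\,d\lambda+\frac1{2\pi}\int_{-\pi}^{\pi}\vec h(\lambda)^\top g(\lambda)\,\overline{\vec h(\lambda)}\,d\lambda .$$ Let $\vec h(f,g)$ denote a minimizer of $\Delta(\cdot\,;f,g)$ over $L_2^s(f+g)$ (the spectral characteristic of the optimal linear estimate), and $\Delta(f,g)=\Delta(\vec h(f,g);f,g)$ the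 minimum. Let $D_f,D_g$ be nonempty sets of spectral densities, $D=D_f\times D_g$, and $H_D=\bigcap_{(f,g)\in D}L_2^s(f+g)$. Let $\delta(\cdot\,|\,D)$ be the function equal to $0$ on $D$ and $+\infty$ off $D$. Let $f^0,g^0$ be spectral densities and $\vec h^0=\vec h(f^0,g^0)$, and suppose that $(f^0,g^0)$ minimizes, over all pairs $(f,g)$ of spectral densities, the functional $$\Delta_D(f,g)=-\Delta(\vec h^0;f,g)+\delta((f,g)\,|\,D)$$ (with value $+\infty$ off $D$). If $\vec h^0\in H_D$, then: 1. $(f^0,g^0)$ is least favorable in $D$, that is, $(f^0,g^0)\in D$ and $\Delta(f^0,g^0)=\max_{(f,g)\in D}\Delta(f,g)$; 2. $\vec h^0$ is the minimax (robust) spectral characteristic, that is, $\vec h^0\in H_D$, the maximum $\max_{(f,g)\in D}\Delta(\vec h^0;f,g)$ is attained, and $$\max_{(f,g)\in D}\Delta(\vec h^0;f,g)=\min_{\vec h\in H_D}\ \sup_{(f,g)\in D}\Delta(\vec h;f,g).$$ -/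

import Mathlib

namespace RobustExtrapolation

open MeasureTheory
open scoped ComplexOrder

noncomputable section

/-- Lebesgue measure `dλ` on one period `(-π, π]`. -/
def circleMeasure : Measure ℝ := volume.restrict (Set.Ioc (-Real.pi) Real.pi)

/-- Spectral density matrices of `T`-variate stationary sequences: integrable matrix functions on
one period whose values are Hermitian positive semidefinite almost everywhere. -/
structure SpectralDensity (T : ℕ) where
  /-- the matrix function -/
  toFun : ℝ → Matrix (Fin T) (Fin T) ℂ
  integrable_entry : ∀ ν μ, Integrable (fun x => toFun x ν μ) circleMeasure
  posSemidef_ae : ∀ᵐ x ∂circleMeasure, (toFun x).PosSemidef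

/-- The sum of two spectral densities (the density of the sum of uncorrelated sequences). -/
instance instAddSpectralDensity {T : ℕ} : Add (SpectralDensity T) where
  add f g :=
    { toFun := fun x => f.toFun x + g.toFun x
      integrable_entry := fun ν μ => (f.integrable_entry ν μ).add (g.integrable_entry ν μ)
      posSemidef_ae := by
        filter_upwards [f.posSemidef_ae, g.posSemidef_ae] with x hf hg
        exact hf.add hg }

/-- `∫ b(λ)ᵀ F(λ) conj(b(λ)) dλ`, with values in `[0, ∞]`; for almost every `λ` the quadratic form
is a nonnegative real number, because `F(λ)` is positive semidefinite. -/
def energy {T : ℕ} (F : SpectralDensity T) (b : ℝ → Fin T → ℂ) : ENNReal :=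
  ∫⁻ x, ENNReal.ofReal (b x ⬝ᵥ (F.toFun x).mulVec (star (b x))).re ∂circleMeasure

/-- The space `L₂(F)` of measurable vector functions `b` with `∫ bᵀ F conj(b) dλ < ∞`. -/
def L2 {T : ℕ} (F : SpectralDensity T) : Set (ℝ → Fin T → ℂ) :=
  {b | AEStronglyMeasurable b circleMeasure ∧ energy F b < ⊤}

/-- `M_l = ∑_{k ≤ l} (N_k + K_k)`, where `N_0 = K_0 = 0`. -/
def partialLength (N K : ℕ → ℕ) (l : ℕ) : ℕ := ∑ k ∈ Finset.Icc 1 l, (N k + K k)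

/-- The set of missing times
`⋃_{l = 1}^{s} {-M_l, …, -M_{l-1} - N_l - 1}`, the `l`-th block having `K_l` elements. -/
def missingTimes (s : ℕ) (N K : ℕ → ℕ) : Set ℤ :=
  {j | ∃ l ∈ Finset.Icc 1 s,
    -(partialLength N K l : ℤ) ≤ j ∧ j ≤ -(partialLength N K (l - 1) : ℤ) - (N l : ℤ) - 1}

/-- The set of times of observation `{…, -2, -1}` without the missing times. -/
def observedTimes (s : ℕ) (N K : ℕ → ℕ) : Set ℤ :=
  {j | j ≤ -1} \ missingTimes s N K

/-- The function `λ ↦ e^{ijλ} δ_ν`. -/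
def harmonic {T : ℕ} (j : ℤ) (ν : Fin T) : ℝ → Fin T → ℂ :=
  fun x => Pi.single ν (Complex.exp (Complex.I * j * x))

/-- Finite linear combinations of the functions `e^{ijλ} δ_ν`, `j` a time of observation. -/
def trigPolynomials (T : ℕ) (s : ℕ) (N K : ℕ → ℕ) : Submodule ℂ (ℝ → Fin T → ℂ) :=
  Submodule.span ℂ {b | ∃ j ∈ observedTimes s N K, ∃ ν : Fin T, b = harmonic j ν}

/-- The subspace `L₂ˢ(F)` of `L₂(F)` generated by the functions `e^{ijλ} δ_ν`, `j` a time of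
observation: the closure of their linear span in `L₂(F)`. -/
def L2s {T : ℕ} (s : ℕ) (N K : ℕ → ℕ) (F : SpectralDensity T) : Set (ℝ → Fin T → ℂ) :=
  {b | b ∈ L2 F ∧
    ∀ ε : ENNReal, 0 < ε → ∃ p ∈ trigPolynomials T s N K, energy F (b - p) < ε}

/-- The blocked coefficients: `a(ν + jT)`, `ν = 1, …, T`, `j ≥ 0`, is the coefficient of
`ζ_ν(j) = ζ(ν + jT)` in `Aζ = ∑_{j ≥ 1} a(j) ζ(j)`. The index `ν : Fin T` stands for `ν + 1`. -/
def blockCoeff {T : ℕ} (a : ℕ → ℂ) (j : ℕ) : Fin T → ℂ :=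
  fun ν => a ((ν : ℕ) + 1 + j * T)

/-- `A(e^{iλ}) = ∑_{j ≥ 0} a⃗(j) e^{ijλ}`. -/
def transferFunction {T : ℕ} (a : ℕ → ℂ) : ℝ → Fin T → ℂ :=
  fun x ν => ∑' j : ℕ, blockCoeff a j ν * Complex.exp (Complex.I * j * x)

/-- The mean square error `Δ(h; f, g)` of the estimate of `Aζ` with spectral characteristic `h`, for
the pair `p = (f, g)` of spectral densities of the signal and of the noise. -/
def mse {T : ℕ} (a : ℕ → ℂ) (h : ℝ → Fin T → ℂ)
    (p : SpectralDensity T × SpectralDensity T) : ENNReal :=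
  ENNReal.ofReal (1 / (2 * Real.pi)) * energy p.1 (transferFunction a - h) +
    ENNReal.ofReal (1 / (2 * Real.pi)) * energy p.2 h

/-- `h` is (a version of) the spectral characteristic `h(f, g)` of the optimal linear estimate of
`Aζ`: it minimizes `Δ(·; f, g)` over `L₂ˢ(f + g)`. -/
def IsOptimalCharacteristic {T : ℕ} (s : ℕ) (N K : ℕ → ℕ) (a : ℕ → ℂ)
    (p : SpectralDensity T × SpectralDensity T) (h : ℝ → Fin T → ℂ) : Prop :=
  h ∈ L2s s N K (p.1 + p.2) ∧ IsMinOn (fun k => mse a k p) (L2s s N K (p.1 + p.2)) h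

/-- The mean square error `Δ(f, g)` of the optimal linear estimate: the least value of
`Δ(h; f, g)` over `h ∈ L₂ˢ(f + g)`. -/
def optimalMse {T : ℕ} (s : ℕ) (N K : ℕ → ℕ) (a : ℕ → ℂ)
    (p : SpectralDensity T × SpectralDensity T) : ENNReal :=
  ⨅ h ∈ L2s s N K (p.1 + p.2), mse a h p

/-- The pair `p` is least favorable in the class `D` for the optimal linear estimation of `Aζ`. -/
def IsLeastFavorable {T : ℕ} (s : ℕ) (N K : ℕ → ℕ) (a : ℕ → ℂ)
    (D : Set (SpectralDensity T × SpectralDensity T))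
    (p : SpectralDensity T × SpectralDensity T) : Prop :=
  p ∈ D ∧ IsMaxOn (optimalMse s N K a) D p

/-- `H_D`, the intersection of the spaces `L₂ˢ(f + g)` over `(f, g) ∈ D`. -/
def admissibleCharacteristics {T : ℕ} (s : ℕ) (N K : ℕ → ℕ)
    (D : Set (SpectralDensity T × SpectralDensity T)) : Set (ℝ → Fin T → ℂ) :=
  ⋂ p ∈ D, L2s s N K (p.1 + p.2)

/-- `h` is minimax (robust) for the class `D`: it belongs to `H_D`, the maximum of `Δ(h; ·)` over
`D` is attained, and it is the least among the suprema of `Δ(k; ·)` over `D`, `k ∈ H_D`. -/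
def IsMinimax {T : ℕ} (s : ℕ) (N K : ℕ → ℕ) (a : ℕ → ℂ)
    (D : Set (SpectralDensity T × SpectralDensity T)) (h : ℝ → Fin T → ℂ) : Prop :=
  h ∈ admissibleCharacteristics s N K D ∧
    (∃ p ∈ D, IsMaxOn (mse a h) D p) ∧
    IsMinOn (fun k => ⨆ p ∈ D, mse a k p) (admissibleCharacteristics s N K D) h

open Classical in
/-- The indicator function `δ(· | D)` of convex analysis: `0` on `D` and `+∞` off `D`. -/
def indicatorFn {X : Type*} (D : Set X) (x : X) : EReal := if x ∈ D then 0 else ⊤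

/-- The functional `Δ_D = -Δ(h; ·) + δ(· | D)`. It is written as `-(Δ - δ)`, which gives the value
`+∞` off `D` also where `Δ(h; ·)` is infinite. -/
def penalizedObjective {T : ℕ} (a : ℕ → ℂ) (h : ℝ → Fin T → ℂ)
    (D : Set (SpectralDensity T × SpectralDensity T))
    (p : SpectralDensity T × SpectralDensity T) : EReal :=
  -((mse a h p : EReal) - indicatorFn D p)

end

end RobustExtrapolation

/-!
The pair `(h₀, (f₀, g₀))` is a saddle point of the mean square error `Δ` on `H_D × D`.

Off `D` the functional `Δ_D` is `+∞`, and on `D` it is `-Δ(h₀; ·)`, which is never `+∞`; so a global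
minimizer of `Δ_D` lies in the nonempty set `D` and maximizes `Δ(h₀; ·)` there
(`mem_and_isMaxOn_mse_of_isMinOn_penalizedObjective`). On the other side `h₀` minimizes
`Δ(·; f₀, g₀)` over `L₂ˢ(f₀ + g₀) ⊇ H_D`. For `(f, g) ∈ D` and `k ∈ H_D` this gives
`Δ(f, g) ≤ Δ(h₀; f, g) ≤ Δ(h₀; f₀, g₀) = Δ(f₀, g₀)` and
`sup_D Δ(h₀; ·) = Δ(h₀; f₀, g₀) ≤ Δ(k; f₀, g₀) ≤ sup_D Δ(k; ·)`;
the first inequality of the first chain is where `h₀ ∈ H_D` enters.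
-/

namespace RobustExtrapolation

section

variable {T : ℕ} {s : ℕ} {N K : ℕ → ℕ} {a : ℕ → ℂ} {h : ℝ → Fin T → ℂ}
  {D : Set (SpectralDensity T × SpectralDensity T)} {p : SpectralDensity T × SpectralDensity T}

theorem penalizedObjective_of_mem (hp : p ∈ D) :
    penalizedObjective a h D p = -(mse a h p : EReal) := by
  simp [penalizedObjective, indicatorFn, hp]

theorem penalizedObjective_of_notMem (hp : p ∉ D) : penalizedObjective a h D p = ⊤ := by
  simp [penalizedObjective, indicatorFn, hp]

theorem mem_and_isMaxOn_mse_of_isMinOn_penalizedObjective (hD : D.Nonempty)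
    (hp : IsMinOn (penalizedObjective a h D) Set.univ p) : p ∈ D ∧ IsMaxOn (mse a h) D p := by
  have hle := isMinOn_univ_iff.1 hp
  have hpD : p ∈ D := by
    by_contra hpD
    obtain ⟨q, hq⟩ := hD
    have hqp := hle q
    rw [penalizedObjective_of_notMem hpD, penalizedObjective_of_mem hq, top_le_iff,
      EReal.neg_eq_top_iff] at hqp
    exact EReal.coe_ennreal_ne_bot _ hqp
  refine ⟨hpD, isMaxOn_iff.2 fun q hq => ?_⟩
  have hqp := hle q
  rwa [penalizedObjective_of_mem hpD, penalizedObjective_of_mem hq, EReal.neg_le_neg_iff,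
    EReal.coe_ennreal_le_coe_ennreal_iff] at hqp

theorem IsOptimalCharacteristic.optimalMse_eq (hh : IsOptimalCharacteristic s N K a p h) :
    optimalMse s N K a p = mse a h p :=
  le_antisymm (iInf₂_le h hh.1) (le_iInf₂ fun _ hk => isMinOn_iff.1 hh.2 _ hk)

theorem isLeastFavorable_of_isMaxOn_mse (hh : IsOptimalCharacteristic s N K a p h)
    (hH : h ∈ admissibleCharacteristics s N K D) (hpD : p ∈ D) (hmax : IsMaxOn (mse a h) D p) :
    IsLeastFavorable s N K a D p := by
  refine ⟨hpD, isMaxOn_iff.2 fun q hq => ?_⟩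
  calc optimalMse s N K a q ≤ mse a h q := iInf₂_le h (Set.mem_iInter₂.1 hH q hq)
    _ ≤ mse a h p := isMaxOn_iff.1 hmax q hq
    _ = optimalMse s N K a p := hh.optimalMse_eq.symm

theorem isMinimax_of_isMaxOn_mse (hh : IsOptimalCharacteristic s N K a p h)
    (hH : h ∈ admissibleCharacteristics s N K D) (hpD : p ∈ D) (hmax : IsMaxOn (mse a h) D p) :
    IsMinimax s N K a D h := by
  refine ⟨hH, ⟨p, hpD, hmax⟩, isMinOn_iff.2 fun k hk => ?_⟩
  calc ⨆ q ∈ D, mse a h q ≤ mse a h p := iSup₂_le fun q hq => isMaxOn_iff.1 hmax q hq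
    _ ≤ mse a k p := isMinOn_iff.1 hh.2 k (Set.mem_iInter₂.1 hk p hpD)
    _ ≤ ⨆ q ∈ D, mse a k q := le_iSup₂ (f := fun q (_ : q ∈ D) => mse a k q) p hpD

end

end RobustExtrapolation

theorem mainTheorem5 (T : ℕ) (hT : 0 < T)
    (s : ℕ) (N K : ℕ → ℕ)
    (a : ℕ → ℂ) (ha : Summable (fun j => ‖a j‖))
    (Df Dg : Set (RobustExtrapolation.SpectralDensity T))
    (hDf : Df.Nonempty) (hDg : Dg.Nonempty)
    (f₀ g₀ : RobustExtrapolation.SpectralDensity T)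
    (h₀ : ℝ → Fin T → ℂ)
    (hh₀ : RobustExtrapolation.IsOptimalCharacteristic s N K a (f₀, g₀) h₀)
    (hsol : IsMinOn (RobustExtrapolation.penalizedObjective a h₀ (Df ×ˢ Dg)) Set.univ (f₀, g₀))
    (hH : h₀ ∈ RobustExtrapolation.admissibleCharacteristics s N K (Df ×ˢ Dg)) :
    RobustExtrapolation.IsLeastFavorable s N K a (Df ×ˢ Dg) (f₀, g₀) ∧
      RobustExtrapolation.IsMinimax s N K a (Df ×ˢ Dg) h₀ := by
  obtain ⟨hpD, hmax⟩ :=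
    RobustExtrapolation.mem_and_isMaxOn_mse_of_isMinOn_penalizedObjective (hDf.prod hDg) hsol
  exact ⟨RobustExtrapolation.isLeastFavorable_of_isMaxOn_mse hh₀ hH hpD hmax,
    RobustExtrapolation.isMinimax_of_isMaxOn_mse hh₀ hH hpD hmax⟩
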